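/- Let $H$ be a finite dimensional semisimple Hopf algebra, with comultiplication $\Delta$, counit $\varepsilon$ and antipode $S$, over an algebraically closed field $k$ of positive characteristic $p$ with $p>(\dim_k H)^{1/2}$ and $p\nmid 2\dim_k H$. Let $V_0,\dots,V_{m-1}$ be a complete list of pairwise non-isomorphic simple $H$-modules, $V_0$ being the trivial module, with characters $\chi_i$ and dimensions $d_i$, and let $e_i\in H$ be the central primitive idempotent that acts as the identity on $V_i$ and annihilates $V_j$ for $j\ne i$. Let $\Lambda\in H$ be a left integral and $\lambda\in H^*$ a right integral with $\lambda(\Lambda)=1$, put $u=S(\Lambda_{(2)})\Lambda_{(1)}$, and, for square roots $s=\sqrt{\varepsilon(\Lambda)}$ and $r_i=\sqrt{\lambda(e_i)}$ in $k$, $$v=\frac{u}{s}\sum_{i=0}^{m-1}\frac{r_i}{d_i}\,e_i .$$ Let $G_0(H)$ be the Grothendieck group of finite dimensional $H$-modules. The $k$-linear map $G_0(H)\otimes_{\mathbb Z}k\to H^*$ that sends the class of a module to its character is injective, and it sends $[V_0]$ to $\varepsilon$; regard $G_0(H)\otimes_{\mathbb Z}k$ as a subspace of $H^*$ through it. Then: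 (a) The roots can be chosen such that $s r_0=1$ and such that, in case $S^2=\mathrm{id}$, $s r_i=d_i$ for all $i$. (b) For every choice of the roots, $v$ is invertible, and the bilinear operation $$(\chi\star\psi)(h)=(\chi\otimes\psi)\bigl(\Delta(h)\Delta(v^{-1})(v\otimes v)\bigr),\qquad h\in H,$$ maps $G_0(H)\otimes_{\mathbb Z}k$ into itself and is associative there. If $s r_0=1$, then $\varepsilon$ is a two-sided unit for $\star$, so that $(G_0(H)\otimes_{\mathbb Z}k,\star)$ is an associative $k$-algebra with unit $\varepsilon$. (c) If $S^2=\mathrm{id}$ and the roots satisfy $s r_i=d_i$ for all $i$, then $\star$ is the convolution $(\chi*\psi)(h)=(\chi\otimes\psi)(\Delta(h))$ on $G_0(H)\otimes_{\mathbb Z}k$. -/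

import Mathlib

open scoped TensorProduct

universe w u

noncomputable section

namespace HopfStar

/-- The trace of an endomorphism of a short exact sequence of finite dimensional vector spaces
is additive. -/
theorem trace_of_exact {k : Type*} [Field k] {L M N : Type*}
    [AddCommGroup L] [Module k L] [Module.Finite k L]
    [AddCommGroup M] [Module k M] [Module.Finite k M]
    [AddCommGroup N] [Module k N] [Module.Finite k N]
    (f : L →ₗ[k] M) (g : M →ₗ[k] N) (hf : Function.Injective f) (hg : Function.Surjective g)
    (hfg : Function.Exact f g) (a : L →ₗ[k] L) (b : M →ₗ[k] M) (c : N →ₗ[k] N)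
    (hab : b ∘ₗ f = f ∘ₗ a) (hbc : g ∘ₗ b = c ∘ₗ g) :
    LinearMap.trace k M b = LinearMap.trace k L a + LinearMap.trace k N c := by
  obtain ⟨s, hs⟩ := g.exists_rightInverse_of_surjective (LinearMap.range_eq_top.mpr hg)
  obtain ⟨e, rfl, rfl⟩ := ((Function.Exact.split_tfae' hfg).out 0 2 rfl rfl).mp ⟨hf, s, hs⟩
  have hsplit : b = (b ∘ₗ e.symm.toLinearMap ∘ₗ LinearMap.inl k L N) ∘ₗ
        (LinearMap.fst k L N ∘ₗ e.toLinearMap) +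
      (b ∘ₗ e.symm.toLinearMap ∘ₗ LinearMap.inr k L N) ∘ₗ
        (LinearMap.snd k L N ∘ₗ e.toLinearMap) := by
    ext x
    simp [← map_add]
  rw [hsplit, map_add, LinearMap.trace_comp_comm', LinearMap.trace_comp_comm' (M := M) (N := N)]
  congr 2
  · rw [hab]
    ext x
    simp
  · ext x
    have := LinearMap.congr_fun hbc (e.symm (0, x))
    simpa using this

section Modules

variable (k : Type w) [Field k] (H : Type u) [Ring H] [Algebra k H]

/-- Finite dimensional (left) modules over the `k`-algebra `H`, bundled. -/
structure FinModule where
  carrier : Type u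
  [addCommGroup : AddCommGroup carrier]
  [moduleK : Module k carrier]
  [moduleH : Module H carrier]
  [isScalarTower : IsScalarTower k H carrier]
  [finite : Module.Finite k carrier]

attribute [instance] FinModule.addCommGroup FinModule.moduleK FinModule.moduleH
  FinModule.isScalarTower FinModule.finite

/-- The character of an `H`-module `V`: `h ↦ tr_V (x ↦ h • x)`. -/
def character (V : Type*) [AddCommGroup V] [Module k V] [Module H V] [IsScalarTower k H V] :
    Module.Dual k H :=
  LinearMap.trace k V ∘ₗ (Algebra.lsmul k k V : H →ₐ[k] Module.End k V).toLinearMap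

/-- The subgroup generated by `[M] - [L] - [N]` for all short exact sequences
`0 → L → M → N → 0` of finite dimensional `H`-modules. -/
def exactRelations : AddSubgroup (FreeAbelianGroup (FinModule.{w, u} k H)) :=
  AddSubgroup.closure {x | ∃ (L M N : FinModule.{w, u} k H)
    (f : L.carrier →ₗ[H] M.carrier) (g : M.carrier →ₗ[H] N.carrier),
    Function.Injective f ∧ Function.Surjective g ∧ Function.Exact f g ∧
    x = FreeAbelianGroup.of M - FreeAbelianGroup.of L - FreeAbelianGroup.of N}

/-- The Grothendieck group `G₀(H)` of finite dimensional `H`-modules. -/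
abbrev G0 : Type (max w (u + 1)) :=
  FreeAbelianGroup (FinModule.{w, u} k H) ⧸ exactRelations.{w, u} k H

/-- The scalar extension `G₀(H) ⊗_ℤ k` (with `k` written on the left). -/
abbrev G0k : Type (max w (u + 1)) := k ⊗[ℤ] G0.{w, u} k H

/-- The class `[V]` in `G₀(H) ⊗_ℤ k` of a finite dimensional `H`-module `V`. -/
def cls (V : Type u) [AddCommGroup V] [Module k V] [Module H V] [IsScalarTower k H V]
    [Module.Finite k V] : G0k.{w, u} k H :=
  (1 : k) ⊗ₜ[ℤ] (QuotientAddGroup.mk (FreeAbelianGroup.of (FinModule.mk V)))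

/-- The additive map `G₀(H) → H*`, `[V] ↦ χ_V`. -/
def characterHom : G0.{w, u} k H →+ Module.Dual k H :=
  QuotientAddGroup.lift (exactRelations.{w, u} k H)
    (FreeAbelianGroup.lift fun M => character k H M.carrier) (by
      rw [exactRelations, AddSubgroup.closure_le]
      rintro x ⟨L, M, N, f, g, hf, hg, hfg, rfl⟩
      simp only [SetLike.mem_coe, AddMonoidHom.mem_ker, map_sub, FreeAbelianGroup.lift_apply_of]
      rw [sub_sub, sub_eq_zero]
      ext h
      exact trace_of_exact (f.restrictScalars k) (g.restrictScalars k) hf hg hfg _ _ _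
        (by ext x; simp) (by ext x; simp))

/-- The `k`-linear map `G₀(H) ⊗_ℤ k → H*` with `[V] ⊗ a ↦ a χ_V`, through which elements of
`G₀(H) ⊗_ℤ k` are regarded as linear functions on `H`. -/
def characterMap : G0k.{w, u} k H →ₗ[k] Module.Dual k H :=
  LinearMap.liftBaseChange k (characterHom.{w, u} k H).toIntLinearMap

theorem characterMap_cls (V : Type u) [AddCommGroup V] [Module k V] [Module H V]
    [IsScalarTower k H V] [Module.Finite k V] :
    characterMap.{w, u} k H (cls.{w, u} k H V) = character k H V := by
  simp [characterMap, cls, characterHom]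

end Modules

section Hopf

variable {k : Type w} [Field k] {H : Type u} [Ring H] [HopfAlgebra k H]

/-- `Λ ∈ H` is a left integral: `h Λ = ε(h) Λ` for all `h`. -/
def IsLeftIntegral (k : Type w) [Field k] {H : Type u} [Ring H] [HopfAlgebra k H] (Λ : H) : Prop :=
  ∀ h : H, h * Λ = (Coalgebra.counit h : k) • Λ

/-- The function `f ⊗ g` on `H ⊗ H`. -/
def tensorEval (f g : Module.Dual k H) : Module.Dual k (H ⊗[k] H) :=
  TensorProduct.dualDistrib k H H (f ⊗ₜ[k] g)

/-- The convolution product on `H*`: `(f ∗ g)(h) = (f ⊗ g)(Δ(h))`. -/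
def conv (f g : Module.Dual k H) : Module.Dual k H :=
  tensorEval f g ∘ₗ Coalgebra.comul

/-- `lam ∈ H*` is a right integral: `lam ∗ f = f(1) lam` for all `f` in `H*`. -/
def IsRightIntegral (lam : Module.Dual k H) : Prop :=
  ∀ f : Module.Dual k H, conv lam f = f 1 • lam

/-- The element `u = S(Λ₍₂₎) Λ₍₁₎`. -/
def uElt (k : Type w) [Field k] {H : Type u} [Ring H] [HopfAlgebra k H] (Λ : H) : H :=
  LinearMap.mul' k H (TensorProduct.map (HopfAlgebra.antipode k) LinearMap.id
    (TensorProduct.comm k H H (Coalgebra.comul Λ)))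

/-- The element `v = (u / s) ∑ᵢ (rᵢ / dᵢ) eᵢ`, where `s` stands for `√ε(Λ)`, `rᵢ` for `√λ(eᵢ)`
and `dᵢ` for the dimension of the `i`-th simple module. -/
def vElt {ι : Type*} [Fintype ι] (Λ : H) (e : ι → H) (d : ι → ℕ) (s : k) (r : ι → k) : H :=
  (s⁻¹ • uElt k Λ) * ∑ i, (r i / (d i : k)) • e i

/-- `(f ⋆ g)(h) = (f ⊗ g)(Δ(h) Δ(v⁻¹) (v ⊗ v))`. -/
def star (v : H) (f g : Module.Dual k H) : Module.Dual k H :=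
  tensorEval f g ∘ₗ
    LinearMap.mulRight k (Coalgebra.comul (R := k) (Ring.inverse v) * (v ⊗ₜ[k] v)) ∘ₗ
    Coalgebra.comul

theorem star_apply (v : H) (f g : Module.Dual k H) (h : H) :
    star v f g h = tensorEval f g
      (Coalgebra.comul h * Coalgebra.comul (Ring.inverse v) * (v ⊗ₜ[k] v)) := by
  simp [star, mul_assoc]

end Hopf

end HopfStar

end

/-!
The element `u` implements the square of the antipode, because `Λ` is a two-sided integral when `H`
is semisimple. The functions `λ(- Λ₍₁₎)` and the elements `S(Λ₍₂₎)` are dual bases of `H`, whence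
`λ(a u)` is the trace of left multiplication by `a`; as the trace form of the regular representation
is nondegenerate when no `dᵢ` vanishes in `k`, `u` is invertible. Schur's lemma for the central
element `S(u) u` then shows `λ(eᵢ) ≠ 0`, so `v` is `u` times a central unit and also implements
`S²`.

Since both `v ⊗ v` and `Δ(v)` implement `S² ⊗ S²` on `Δ(H)`, the element `Δ(v⁻¹)(v ⊗ v)` commutes
with `Δ(H)`, and therefore `⋆` preserves the space of functions `f` with `f(ab) = f(ba)`. This space
is spanned by the characters of the simple modules, so it is `G₀(H) ⊗ k`. Finally `f ↦ f(- v)`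
carries `⋆` to the convolution product, which makes `⋆` associative.
-/

noncomputable section

namespace HopfStar

section Antipode

open Coalgebra HopfAlgebra WithConv Algebra.TensorProduct

variable {R : Type*} [CommSemiring R] {A : Type*} [Semiring A] [HopfAlgebra R A]

theorem includeLeft_convMul_includeRight :
    toConv (includeLeft : A →ₐ[R] A ⊗[R] A).toLinearMap *
      toConv (includeRight : A →ₐ[R] A ⊗[R] A).toLinearMap = toConv comul := by
  have hid : LinearMap.mul' R (A ⊗[R] A) ∘ₗ TensorProduct.map
      (includeLeft : A →ₐ[R] A ⊗[R] A).toLinearMap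
      (includeRight : A →ₐ[R] A ⊗[R] A).toLinearMap = LinearMap.id :=
    TensorProduct.ext' fun x y => by simp
  exact congrArg (fun f => toConv (f ∘ₗ comul)) hid

theorem algHom_comp_antipode_convMul {B : Type*} [Semiring B] [Algebra R B] (f : A →ₐ[R] B) :
    toConv (f.toLinearMap ∘ₗ antipode R) * toConv f.toLinearMap = 1 := by
  have h := LinearMap.algHom_comp_convMul_distrib f (toConv (antipode R)) (toConv LinearMap.id)
  rw [LinearMap.antipode_mul_id] at h
  exact ofConv_injective (h.symm.trans (by ext a; simp))

theorem convMul_algHom_comp_antipode {B : Type*} [Semiring B] [Algebra R B] (f : A →ₐ[R] B) :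
    toConv f.toLinearMap * toConv (f.toLinearMap ∘ₗ antipode R) = 1 := by
  have h := LinearMap.algHom_comp_convMul_distrib f (toConv LinearMap.id) (toConv (antipode R))
  rw [LinearMap.id_mul_antipode] at h
  exact ofConv_injective (h.symm.trans (by ext a; simp))

theorem includeRight_antipode_convMul_includeLeft_antipode :
    toConv ((includeRight : A →ₐ[R] A ⊗[R] A).toLinearMap ∘ₗ antipode R) *
      toConv ((includeLeft : A →ₐ[R] A ⊗[R] A).toLinearMap ∘ₗ antipode R) =
      toConv (TensorProduct.map (antipode R) (antipode R) ∘ₗ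
        (TensorProduct.comm R A A).toLinearMap ∘ₗ comul) := by
  have hmap : LinearMap.mul' R (A ⊗[R] A) ∘ₗ TensorProduct.map
      ((includeRight : A →ₐ[R] A ⊗[R] A).toLinearMap ∘ₗ antipode R)
      ((includeLeft : A →ₐ[R] A ⊗[R] A).toLinearMap ∘ₗ antipode R) =
      TensorProduct.map (antipode R) (antipode R) ∘ₗ (TensorProduct.comm R A A).toLinearMap :=
    TensorProduct.ext' fun x y => by simp
  exact congrArg (fun f => toConv (f ∘ₗ comul)) hmap

-- Both sides are convolution inverses of `comul = includeLeft * includeRight`.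
theorem comul_antipode (a : A) :
    comul (antipode R a) = TensorProduct.map (antipode R) (antipode R)
      (TensorProduct.comm R A A (comul a)) := by
  have hcomp : TensorProduct.map (antipode R) (antipode R) ∘ₗ
      (TensorProduct.comm R A A).toLinearMap ∘ₗ comul = comul ∘ₗ antipode R := by
    refine toConv_injective
      (left_inv_eq_right_inv (a := toConv (comul : A →ₗ[R] A ⊗[R] A)) ?_ LinearMap.comul_right_inv)
    rw [← includeRight_antipode_convMul_includeLeft_antipode,
      ← includeLeft_convMul_includeRight, mul_assoc,
      ← mul_assoc (toConv (includeLeft.toLinearMap ∘ₗ antipode R)),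
      algHom_comp_antipode_convMul, one_mul, algHom_comp_antipode_convMul]
  exact (LinearMap.congr_fun hcomp a).symm

theorem comul_antipode_antipode (a : A) :
    comul (antipode R (antipode R a)) =
      TensorProduct.map (antipode R ∘ₗ antipode R) (antipode R ∘ₗ antipode R) (comul a) := by
  have hcomm : TensorProduct.map (antipode R) (antipode R) ∘ₗ
      (TensorProduct.comm R A A).toLinearMap ∘ₗ TensorProduct.map (antipode R) (antipode R) ∘ₗ
      (TensorProduct.comm R A A).toLinearMap =
      TensorProduct.map (antipode R ∘ₗ antipode R) (antipode R ∘ₗ antipode R) :=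
    TensorProduct.ext' fun x y => by simp
  rw [comul_antipode, comul_antipode]
  exact LinearMap.congr_fun hcomm (comul a)

theorem sum_comul_mul_one_tmul_antipode (a : A) :
    ∑ i ∈ (ℛ R a).index, comul ((ℛ R a).left i) * (1 ⊗ₜ[R] antipode R ((ℛ R a).right i)) =
      a ⊗ₜ[R] 1 := by
  have hconv : toConv comul *
      toConv ((includeRight : A →ₐ[R] A ⊗[R] A).toLinearMap ∘ₗ antipode R) =
      toConv (includeLeft : A →ₐ[R] A ⊗[R] A).toLinearMap := by
    rw [← includeLeft_convMul_includeRight, mul_assoc, convMul_algHom_comp_antipode, mul_one]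
  exact ((ℛ R a).convMul_apply (toConv comul) (toConv (_ ∘ₗ antipode R))).symm.trans
    (LinearMap.congr_fun (congrArg ofConv hconv) a)

end Antipode

section TraceForms

/-- The linear functions `f` on an algebra with `f (a b) = f (b a)`. Those on `H` will be the
image of `G₀(H) ⊗ k` in `H*`. -/
def traceForms (R A : Type*) [CommSemiring R] [Semiring A] [Algebra R A] :
    Submodule R (Module.Dual R A) where
  carrier := {f | ∀ a b, f (a * b) = f (b * a)}
  add_mem' hf hg a b := by simp [hf a b, hg a b]
  zero_mem' _ _ := rfl
  smul_mem' c f hf a b := by simp [hf a b]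

theorem trace_mem_traceForms (R M : Type*) [CommRing R] [AddCommGroup M] [Module R M] :
    LinearMap.trace R M ∈ traceForms R (Module.End R M) :=
  LinearMap.trace_mul_comm R

theorem comp_algHom_mem_traceForms {R A B : Type*} [CommSemiring R] [Semiring A] [Algebra R A]
    [Semiring B] [Algebra R B] {f : Module.Dual R B} (hf : f ∈ traceForms R B) (Φ : A →ₐ[R] B) :
    f ∘ₗ Φ.toLinearMap ∈ traceForms R A := fun a b => by
  simp [hf (Φ a)]

theorem mem_traceForms_of_comp_algHom {R A B : Type*} [CommSemiring R] [Semiring A] [Algebra R A]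
    [Semiring B] [Algebra R B] {f : Module.Dual R B} {Φ : A →ₐ[R] B}
    (hΦ : Function.Surjective Φ) (hf : f ∘ₗ Φ.toLinearMap ∈ traceForms R A) :
    f ∈ traceForms R B := fun x y => by
  obtain ⟨a, rfl⟩ := hΦ x
  obtain ⟨b, rfl⟩ := hΦ y
  simpa using hf a b

theorem exists_eq_smul_trace_of_mem_traceForms {R M : Type*} [CommRing R] [AddCommGroup M]
    [Module R M] [Module.Free R M] [Module.Finite R M] {g : Module.Dual R (Module.End R M)}
    (hg : g ∈ traceForms R (Module.End R M)) : ∃ c : R, g = c • LinearMap.trace R M := by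
  rcases isEmpty_or_nonempty (Module.Free.ChooseBasisIndex R M) with hι | ⟨⟨i₀⟩⟩
  · have hM : Subsingleton M := (Module.Free.chooseBasis R M).repr.subsingleton
    exact ⟨0, LinearMap.ext fun f => by rw [Subsingleton.elim f 0, map_zero, map_zero]⟩
  set b := Module.Free.chooseBasis R M
  -- A product of two rank one maps, taken in the opposite order, is a multiple of the map at `i₀`.
  obtain ⟨c, hc⟩ : ∃ c, ∀ (ψ : Module.Dual R M) (y : M), g (ψ.smulRight y) = c * ψ y := by
    refine ⟨g ((b.coord i₀).smulRight (b i₀)), fun ψ y => ?_⟩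
    have hmul : (b.coord i₀).smulRight y * ψ.smulRight (b i₀) = ψ.smulRight y := by
      ext; simp
    have hmul_swap : ψ.smulRight (b i₀) * (b.coord i₀).smulRight y =
        ψ y • (b.coord i₀).smulRight (b i₀) := by
      ext; simp [smul_smul, mul_comm]
    rw [← hmul, hg, hmul_swap, map_smul, smul_eq_mul, mul_comm]
  refine ⟨c, LinearMap.ext fun f => ?_⟩
  have hf : f = ∑ i, (b.coord i).smulRight (f (b i)) := by
    ext x
    conv_lhs => rw [← b.sum_repr x]
    simp only [map_sum, map_smul, LinearMap.coe_sum, Finset.sum_apply,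
      LinearMap.smulRight_apply, Module.Basis.coord_apply]
  rw [hf, map_sum, map_sum]
  simp only [hc, LinearMap.smul_apply, LinearMap.trace_smulRight, smul_eq_mul]

theorem counit_mem_traceForms (R A : Type*) [CommSemiring R] [Semiring A] [Bialgebra R A] :
    Coalgebra.counit ∈ traceForms R A := fun a b => by
  rw [Bialgebra.counit_mul, Bialgebra.counit_mul, mul_comm]

theorem character_mem_traceForms (k : Type*) [Field k] (A : Type*) [Ring A] [Algebra k A]
    (V : Type*) [AddCommGroup V] [Module k V] [Module A V] [IsScalarTower k A V] :
    character k A V ∈ traceForms k A :=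
  comp_algHom_mem_traceForms (trace_mem_traceForms k V) _

end TraceForms

section Integrals

open Coalgebra HopfAlgebra

variable {k : Type w} [Field k] {H : Type u} [Ring H] [HopfAlgebra k H]

/-- `Λ ∈ H` is a right integral: `Λ h = ε(h) Λ` for all `h`. The name `IsRightIntegral` belongs
to the right integrals in `H*`. -/
def IsRightIntegralElt (k : Type w) [Field k] {H : Type u} [Ring H] [HopfAlgebra k H] (Λ : H) :
    Prop :=
  ∀ h : H, Λ * h = (counit h : k) • Λ

theorem IsRightIntegralElt.comul_mul_tmul_one {Λ : H} (hΛ : IsRightIntegralElt k Λ) (h : H) :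
    comul Λ * (h ⊗ₜ[k] 1) = comul Λ * (1 ⊗ₜ[k] antipode k h) := by
  rw [← sum_comul_mul_one_tmul_antipode h, Finset.mul_sum]
  simp_rw [← mul_assoc, ← Bialgebra.comul_mul, hΛ _, map_smul, smul_mul_assoc]
  simp_rw [← mul_smul_comm, ← TensorProduct.tmul_smul, ← map_smul]
  rw [← Finset.mul_sum, ← TensorProduct.tmul_sum, ← map_sum, sum_counit_smul]

theorem uElt_eq_sum (Λ : H) :
    uElt k Λ = ∑ i ∈ (ℛ k Λ).index, antipode k ((ℛ k Λ).right i) * (ℛ k Λ).left i := by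
  rw [uElt]
  conv_lhs => rw [← (ℛ k Λ).eq]
  simp only [map_sum, TensorProduct.comm_tmul, TensorProduct.map_tmul, LinearMap.id_coe, id_eq,
    LinearMap.mul'_apply]

theorem IsRightIntegralElt.semiconjBy_uElt {Λ : H} (hΛ : IsRightIntegralElt k Λ) (h : H) :
    SemiconjBy (uElt k Λ) h (antipode k (antipode k h)) := by
  let contract : H ⊗[k] H →ₗ[k] H := LinearMap.mul' k H ∘ₗ
    TensorProduct.map (antipode k) LinearMap.id ∘ₗ (TensorProduct.comm k H H).toLinearMap
  have hleft : contract ∘ₗ LinearMap.mulRight k (h ⊗ₜ[k] 1) = LinearMap.mulRight k h ∘ₗ contract :=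
    TensorProduct.ext' fun x y => by simp [contract, mul_assoc]
  have hright : contract ∘ₗ LinearMap.mulRight k (1 ⊗ₜ[k] antipode k h) =
      LinearMap.mulLeft k (antipode k (antipode k h)) ∘ₗ contract :=
    TensorProduct.ext' fun x y => by simp [contract, mul_assoc, antipode_mul_antidistrib]
  calc contract (comul Λ) * h = contract (comul Λ * (h ⊗ₜ[k] 1)) := by
        simpa using (LinearMap.congr_fun hleft (comul Λ)).symm
    _ = contract (comul Λ * (1 ⊗ₜ[k] antipode k h)) := by rw [hΛ.comul_mul_tmul_one]
    _ = antipode k (antipode k h) * contract (comul Λ) := by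
        simpa using LinearMap.congr_fun hright (comul Λ)

theorem apply_uElt_of_mem_traceForms {f : Module.Dual k H} (hf : f ∈ traceForms k H) (Λ : H) :
    f (uElt k Λ) = counit Λ * f 1 := by
  rw [uElt_eq_sum, map_sum]
  simp_rw [hf (antipode k _)]
  rw [← map_sum, sum_mul_antipode_eq_smul, map_smul, smul_eq_mul]

theorem counit_uElt (Λ : H) : counit (uElt k Λ) = (counit Λ : k) := by
  rw [apply_uElt_of_mem_traceForms (counit_mem_traceForms k H), Bialgebra.counit_one, mul_one]

theorem uElt_of_antipode_antipode (hS : ∀ h : H, antipode k (antipode k h) = h) (Λ : H) :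
    uElt k Λ = (counit Λ : k) • 1 :=
  calc uElt k Λ = ∑ i ∈ (ℛ k Λ).index,
        antipode k (antipode k ((ℛ k Λ).left i) * (ℛ k Λ).right i) := by
        simp_rw [uElt_eq_sum, antipode_mul_antidistrib, hS]
    _ = (counit Λ : k) • 1 := by
        rw [← map_sum, sum_antipode_mul_eq_smul, map_smul, antipode_one]

@[simp]
theorem tensorEval_tmul (f g : Module.Dual k H) (x y : H) :
    tensorEval f g (x ⊗ₜ[k] y) = f x * g y := by
  simp [tensorEval]

/-- The map `f ⊗ id : H ⊗ H → H`. -/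
def contractLeft (f : Module.Dual k H) : H ⊗[k] H →ₗ[k] H :=
  TensorProduct.lid k H ∘ₗ TensorProduct.map f LinearMap.id

@[simp]
theorem contractLeft_tmul (f : Module.Dual k H) (x y : H) :
    contractLeft f (x ⊗ₜ[k] y) = f x • y := by
  simp [contractLeft]

theorem contractLeft_mul_one_tmul (f : Module.Dual k H) (t : H ⊗[k] H) (y : H) :
    contractLeft f (t * (1 ⊗ₜ[k] y)) = contractLeft f t * y := by
  have h : contractLeft f ∘ₗ LinearMap.mulRight k (1 ⊗ₜ[k] y) =
      LinearMap.mulRight k y ∘ₗ contractLeft f :=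
    TensorProduct.ext' fun a b => by simp
  exact LinearMap.congr_fun h t

theorem apply_contractLeft (f g : Module.Dual k H) (t : H ⊗[k] H) :
    g (contractLeft f t) = tensorEval f g t := by
  have h : g ∘ₗ contractLeft f = tensorEval f g := TensorProduct.ext' fun a b => by simp
  exact LinearMap.congr_fun h t

theorem IsRightIntegral.contractLeft_comul {lam : Module.Dual k H} (hlam : IsRightIntegral lam)
    (h : H) : contractLeft lam (comul h) = lam h • 1 := by
  rw [← sub_eq_zero, ← Module.forall_dual_apply_eq_zero_iff k]
  intro f
  rw [map_sub, apply_contractLeft, map_smul, sub_eq_zero]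
  exact (LinearMap.congr_fun (hlam f) h).trans (mul_comm _ _)

theorem IsRightIntegral.contractLeft_comul_mul {lam : Module.Dual k H}
    (hlam : IsRightIntegral lam) (a b : H) :
    contractLeft lam (comul a * (b ⊗ₜ[k] 1)) =
      ∑ i ∈ (ℛ k b).index, lam (a * (ℛ k b).left i) • antipode k ((ℛ k b).right i) := by
  rw [← sum_comul_mul_one_tmul_antipode b, Finset.mul_sum, map_sum]
  refine Finset.sum_congr rfl fun i _ => ?_
  rw [← mul_assoc, ← Bialgebra.comul_mul, contractLeft_mul_one_tmul, hlam.contractLeft_comul,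
    smul_mul_assoc, one_mul]

/-- A left integral `Λ` in `H` and a right integral `lam` in `H*`, normalized by
`lam Λ = 1`. -/
structure IsDualIntegralPair (Λ : H) (lam : Module.Dual k H) : Prop where
  left : IsLeftIntegral k Λ
  right : IsRightIntegral lam
  apply_eq_one : lam Λ = 1

namespace IsDualIntegralPair

variable {Λ : H} {lam : Module.Dual k H}

-- The functions `lam (- Λ₍₁₎)` and the elements `S(Λ₍₂₎)` are dual bases of `H`.
theorem sum_smul_antipode (hΛ : IsDualIntegralPair Λ lam) (a : H) :
    ∑ i ∈ (ℛ k Λ).index, lam (a * (ℛ k Λ).left i) • antipode k ((ℛ k Λ).right i) = a := by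
  rw [← hΛ.right.contractLeft_comul_mul]
  conv_lhs => rw [← (ℛ k a).eq]
  simp only [Finset.sum_mul, Algebra.TensorProduct.tmul_mul_tmul, mul_one, map_sum,
    contractLeft_tmul, hΛ.left _, map_smul, hΛ.apply_eq_one, smul_eq_mul]
  exact sum_counit_smul (ℛ k a)

theorem antipode_surjective (hΛ : IsDualIntegralPair Λ lam) :
    Function.Surjective (antipode k : H →ₗ[k] H) := fun a =>
  ⟨∑ i ∈ (ℛ k Λ).index, lam (a * (ℛ k Λ).left i) • (ℛ k Λ).right i, by
    simp_rw [map_sum, map_smul]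
    exact hΛ.sum_smul_antipode a⟩

theorem apply_mul_uElt [Module.Finite k H] (hΛ : IsDualIntegralPair Λ lam) (a : H) :
    lam (a * uElt k Λ) = character k H H a := by
  have hmulLeft : LinearMap.mulLeft k a = ∑ i ∈ (ℛ k Λ).index,
      (lam ∘ₗ LinearMap.mulRight k ((ℛ k Λ).left i)).smulRight
        (a * antipode k ((ℛ k Λ).right i)) := by
    ext x
    simp only [LinearMap.mulLeft_apply, LinearMap.coe_sum, Finset.sum_apply,
      LinearMap.smulRight_apply, LinearMap.comp_apply, LinearMap.mulRight_apply]
    conv_lhs => rw [← hΛ.sum_smul_antipode x]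
    simp only [Finset.mul_sum, mul_smul_comm]
  change _ = LinearMap.trace k H (LinearMap.mulLeft k a)
  rw [hmulLeft, uElt_eq_sum, Finset.mul_sum, map_sum, map_sum]
  refine Finset.sum_congr rfl fun i _ => ?_
  rw [LinearMap.trace_smulRight, LinearMap.comp_apply, LinearMap.mulRight_apply, mul_assoc]

end IsDualIntegralPair

end Integrals

section Star

open Coalgebra HopfAlgebra WithConv

variable {k : Type w} [Field k] {H : Type u} [Ring H] [HopfAlgebra k H]

theorem conv_eq_convMul (f g : Module.Dual k H) : conv f g = (toConv f * toConv g).ofConv := by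
  have h : tensorEval f g = LinearMap.mul' k k ∘ₗ TensorProduct.map f g :=
    TensorProduct.ext' fun x y => by simp
  exact congrArg (· ∘ₗ comul) h

theorem conv_assoc (f g h : Module.Dual k H) : conv (conv f g) h = conv f (conv g h) := by
  simp only [conv_eq_convMul, toConv_ofConv, mul_assoc]

theorem counit_conv (f : Module.Dual k H) : conv counit f = f := by
  rw [conv_eq_convMul]
  exact congrArg ofConv (one_mul (toConv f))

theorem conv_counit (f : Module.Dual k H) : conv f counit = f := by
  rw [conv_eq_convMul]
  exact congrArg ofConv (mul_one (toConv f))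

theorem conv_smul_left (c : k) (f g : Module.Dual k H) : conv (c • f) g = c • conv f g := by
  rw [conv_eq_convMul, conv_eq_convMul, toConv_smul, smul_mul_assoc, ofConv_smul]

theorem conv_smul_right (c : k) (f g : Module.Dual k H) : conv f (c • g) = c • conv f g := by
  rw [conv_eq_convMul, conv_eq_convMul, toConv_smul, mul_smul_comm, ofConv_smul]

theorem star_eq_conv_comp_mulRight (v : H) (f g : Module.Dual k H) :
    star v f g = conv (f ∘ₗ LinearMap.mulRight k v) (g ∘ₗ LinearMap.mulRight k v) ∘ₗ
      LinearMap.mulRight k (Ring.inverse v) := by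
  have h : tensorEval f g ∘ₗ LinearMap.mulRight k (v ⊗ₜ[k] v) =
      tensorEval (f ∘ₗ LinearMap.mulRight k v) (g ∘ₗ LinearMap.mulRight k v) :=
    TensorProduct.ext' fun x y => by simp
  ext a
  rw [star_apply, ← Bialgebra.comul_mul, LinearMap.comp_apply, LinearMap.mulRight_apply]
  exact LinearMap.congr_fun h (comul (a * Ring.inverse v))

theorem star_comp_mulRight {v : H} (hv : IsUnit v) (f g : Module.Dual k H) :
    star v f g ∘ₗ LinearMap.mulRight k v =
      conv (f ∘ₗ LinearMap.mulRight k v) (g ∘ₗ LinearMap.mulRight k v) := by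
  rw [star_eq_conv_comp_mulRight]
  ext h
  simp [mul_assoc, Ring.mul_inverse_cancel v hv]

theorem star_assoc {v : H} (hv : IsUnit v) (f g h : Module.Dual k H) :
    star v (star v f g) h = star v f (star v g h) := by
  rw [star_eq_conv_comp_mulRight v (star v f g), star_eq_conv_comp_mulRight v f (star v g h),
    star_comp_mulRight hv, star_comp_mulRight hv, conv_assoc]

theorem counit_comp_mulRight (v : H) :
    (counit : Module.Dual k H) ∘ₗ LinearMap.mulRight k v = (counit v : k) • counit := by
  ext h
  simp [mul_comm]

theorem counit_star {v : H} (hv : IsUnit v) (f : Module.Dual k H) :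
    star v counit f = (counit v : k) • f := by
  rw [star_eq_conv_comp_mulRight, counit_comp_mulRight, conv_smul_left, counit_conv]
  ext h
  simp [mul_assoc, Ring.inverse_mul_cancel v hv]

theorem star_counit {v : H} (hv : IsUnit v) (f : Module.Dual k H) :
    star v f counit = (counit v : k) • f := by
  rw [star_eq_conv_comp_mulRight, counit_comp_mulRight, conv_smul_right, conv_counit]
  ext h
  simp [mul_assoc, Ring.inverse_mul_cancel v hv]

theorem star_one (f g : Module.Dual k H) : star 1 f g = conv f g := by
  rw [star_eq_conv_comp_mulRight]
  simp

theorem tensorEval_mem_traceForms {f g : Module.Dual k H} (hf : f ∈ traceForms k H)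
    (hg : g ∈ traceForms k H) : tensorEval f g ∈ traceForms k (H ⊗[k] H) := by
  have h : (LinearMap.mul k (H ⊗[k] H)).compr₂ (tensorEval f g) =
      (LinearMap.mul k (H ⊗[k] H)).flip.compr₂ (tensorEval f g) := by
    ext a b c d
    simp [hf a c, hg b d]
  exact LinearMap.congr_fun₂ h

theorem semiconjBy_tmul_comul {v : H} (hv : ∀ h, SemiconjBy v h (antipode k (antipode k h)))
    (h : H) : SemiconjBy (v ⊗ₜ[k] v) (comul h) (comul (R := k) (antipode k (antipode k h))) := by
  have hmap : LinearMap.mulLeft k (v ⊗ₜ[k] v) = LinearMap.mulRight k (v ⊗ₜ[k] v) ∘ₗ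
      TensorProduct.map (antipode k ∘ₗ antipode k) (antipode k ∘ₗ antipode k) :=
    TensorProduct.ext' fun x y => by simp [(hv _).eq]
  rw [comul_antipode_antipode]
  exact LinearMap.congr_fun hmap (comul h)

theorem star_mem_traceForms {v : H} (hv : IsUnit v)
    (hvS : ∀ h, SemiconjBy v h (antipode k (antipode k h))) {f g : Module.Dual k H}
    (hf : f ∈ traceForms k H) (hg : g ∈ traceForms k H) : star v f g ∈ traceForms k H := by
  intro a b
  have hinv : SemiconjBy (Ring.inverse v) (antipode k (antipode k b)) b := by
    obtain ⟨v, rfl⟩ := hv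
    rw [Ring.inverse_unit]
    exact (hvS b).units_inv_symm_left
  have hcomm : Commute (comul (R := k) (Ring.inverse v) * (v ⊗ₜ[k] v)) (comul b) :=
    (hinv.map (Bialgebra.comulAlgHom k H)).mul_left (semiconjBy_tmul_comul hvS b)
  rw [star_apply, star_apply, Bialgebra.comul_mul, Bialgebra.comul_mul, mul_assoc, mul_assoc,
    mul_assoc, ← hcomm.eq, ← mul_assoc, tensorEval_mem_traceForms hf hg]
  simp only [mul_assoc]

/-- The operation `⋆` as a bilinear map. -/
def starBilin (v : H) : Module.Dual k H →ₗ[k] Module.Dual k H →ₗ[k] Module.Dual k H :=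
  (TensorProduct.mk k _ _).compr₂ (LinearMap.lcomp k k
    (LinearMap.mulRight k (comul (R := k) (Ring.inverse v) * (v ⊗ₜ[k] v)) ∘ₗ comul) ∘ₗ
      TensorProduct.dualDistrib k H H)

end Star

section SimpleModules

open Module

theorem trace_mulLeft_end {R M : Type*} [CommRing R] [AddCommGroup M] [Module R M]
    [Module.Free R M] [Module.Finite R M] (f : End R M) :
    LinearMap.trace R (End R M) (LinearMap.mulLeft R f) =
      finrank R M * LinearMap.trace R M f := by
  rcases subsingleton_or_nontrivial R with hR | hR
  · exact Subsingleton.elim _ _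
  set b := Free.chooseBasis R M
  let column i : M →ₗ[R] End R M := LinearMap.smulRightₗ (b.coord i)
  have hcolumn i : LinearMap.applyₗ (b i) ∘ₗ column i = LinearMap.id := by
    ext x; simp [column]
  have hsum : LinearMap.mulLeft R f = ∑ i, column i ∘ₗ (f ∘ₗ LinearMap.applyₗ (b i)) :=
    LinearMap.ext fun g => b.ext fun j => by simp [column, Finsupp.single_apply]
  calc LinearMap.trace R (End R M) (LinearMap.mulLeft R f)
      = ∑ i, LinearMap.trace R M (f ∘ₗ LinearMap.applyₗ (b i) ∘ₗ column i) := by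
        rw [hsum, map_sum]
        exact Finset.sum_congr rfl fun i _ => LinearMap.trace_comp_comm' _ (column i)
    _ = finrank R M * LinearMap.trace R M f := by
        simp [hcolumn, finrank_eq_card_chooseBasisIndex]

variable {k : Type*} [Field k] {A : Type*} [Ring A] [Algebra k A]

section Module

variable (V : Type*) [AddCommGroup V] [Module k V] [Module A V] [IsScalarTower k A V]

theorem character_apply (a : A) :
    character k A V a = LinearMap.trace k V (Algebra.lsmul k k V a) := rfl

variable [Module.Finite k V]

theorem character_one : character k A V 1 = finrank k V := by
  rw [character_apply, map_one, LinearMap.trace_one]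

variable [IsAlgClosed k] [IsSimpleModule A V]

-- By Schur's lemma every `k`-linear map is linear over `End_A V = k`, so density applies to it.
theorem lsmul_surjective : Function.Surjective (Algebra.lsmul k k V : A →ₐ[k] End k V) := by
  intro f
  let f' : End (End A V) V :=
    { toFun := f
      map_add' := map_add f
      map_smul' := fun φ x => by
        obtain ⟨c, rfl⟩ := (IsSimpleModule.algebraMap_end_bijective_of_isAlgClosed k).2 φ
        simp }
  obtain ⟨s, hs⟩ := Module.Finite.fg_top (R := k) (M := V)
  obtain ⟨a, ha⟩ := jacobson_density f' s
  exact ⟨a, LinearMap.ext_on hs fun x hx => (ha x hx).symm⟩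

theorem character_ne_zero : character k A V ≠ 0 := by
  have := IsSimpleModule.nontrivial A V
  obtain ⟨x, hx⟩ := exists_ne (0 : V)
  obtain ⟨φ, hφ⟩ := Module.Projective.exists_dual_ne_zero k hx
  obtain ⟨a, ha⟩ := lsmul_surjective (A := A) V (φ.smulRight x)
  refine DFunLike.ne_iff.mpr ⟨a, ?_⟩
  rwa [character_apply, ha, LinearMap.trace_smulRight]

theorem exists_forall_smul_eq_smul_of_forall_commute {z : A} (hz : ∀ a, Commute z a) :
    ∃ c : k, ∀ x : V, z • x = c • x := by
  let φ : End A V :=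
    { toFun := (z • ·)
      map_add' := smul_add z
      map_smul' := fun a x => by rw [RingHom.id_apply, smul_smul, smul_smul, (hz a).eq] }
  obtain ⟨c, hc⟩ := (IsSimpleModule.algebraMap_end_bijective_of_isAlgClosed k).2 φ
  exact ⟨c, fun x => (LinearMap.congr_fun hc x).symm⟩

variable [Module.Finite k A]

theorem finrank_sq_le : finrank k V ^ 2 ≤ finrank k A := by
  have h := LinearMap.finrank_le_finrank_of_surjective
    (f := (Algebra.lsmul k k V : A →ₐ[k] End k V).toLinearMap) (lsmul_surjective V)
  rwa [finrank_linearMap, ← sq] at h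

theorem finrank_cast_ne_zero (p : ℕ) [CharP k p] (hp : finrank k A < p ^ 2) :
    (finrank k V : k) ≠ 0 := by
  have := IsSimpleModule.nontrivial A V
  rw [Ne, CharP.cast_eq_zero_iff k p]
  exact Nat.not_dvd_of_pos_of_lt finrank_pos
    (lt_of_pow_lt_pow_left₀ 2 p.zero_le ((finrank_sq_le V).trans_lt hp))

end Module

/-- Every simple `A`-module is isomorphic to some member of the family `V`. -/
def IsCompleteListOfSimples.{v} (A : Type*) [Ring A] {ι : Type*} (V : ι → Type v)
    [∀ i, AddCommGroup (V i)] [∀ i, Module A (V i)] : Prop :=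
  ∀ (W : Type v) [AddCommGroup W] [Module A W] [IsSimpleModule A W], ∃ i, Nonempty (W ≃ₗ[A] V i)

theorem IsCompleteListOfSimples.eq_zero_of_forall_smul_eq_zero.{v} {A : Type v} [Ring A]
    [IsSemisimpleRing A] {ι : Type*} {V : ι → Type v} [∀ i, AddCommGroup (V i)]
    [∀ i, Module A (V i)] (hV : IsCompleteListOfSimples A V) {a : A}
    (ha : ∀ i (x : V i), a • x = 0) : a = 0 := by
  suffices a ∈ Ring.jacobson A by rwa [IsSemisimpleRing.jacobson_eq_bot] at this
  refine Submodule.mem_sInf.mpr fun m hm => ?_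
  have := isSimpleModule_iff_isCoatom.mpr hm
  obtain ⟨i, ⟨φ⟩⟩ := hV (A ⧸ m)
  have h : a • (Submodule.Quotient.mk 1 : A ⧸ m) = 0 :=
    φ.injective (by rw [map_smul, ha, map_zero])
  rwa [← Submodule.Quotient.mk_smul, smul_eq_mul, mul_one, Submodule.Quotient.mk_eq_zero] at h

/-- The elements `e i` are the block idempotents of a family `V` of modules that is jointly
faithful: `e i` acts as the identity on `V i` and as zero on `V j` for `j ≠ i`. -/
structure IsBlockSystem {A : Type*} [Ring A] {ι : Type*} (V : ι → Type*)
    [∀ i, AddCommGroup (V i)] [∀ i, Module A (V i)] (e : ι → A) : Prop where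
  faithful : ∀ a : A, (∀ i (x : V i), a • x = 0) → a = 0
  smul_self : ∀ i (x : V i), e i • x = x
  smul_other : ∀ i j, j ≠ i → ∀ x : V j, e i • x = 0

namespace IsBlockSystem

variable {ι : Type*} {V : ι → Type*} [∀ i, AddCommGroup (V i)] [∀ i, Module A (V i)] {e : ι → A}

theorem ext (he : IsBlockSystem V e) {a b : A} (hab : ∀ i (x : V i), a • x = b • x) : a = b :=
  sub_eq_zero.mp (he.faithful _ fun i x => by rw [sub_smul, hab, sub_self])

theorem commute (he : IsBlockSystem V e) (i : ι) (a : A) : Commute (e i) a := by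
  refine he.ext fun j x => ?_
  rw [mul_smul, mul_smul]
  rcases eq_or_ne j i with rfl | hj
  · rw [he.smul_self, he.smul_self]
  · rw [he.smul_other i j hj, he.smul_other i j hj, smul_zero]

theorem mul_eq_zero_iff (he : IsBlockSystem V e) (i : ι) (a : A) :
    e i * a = 0 ↔ ∀ x : V i, a • x = 0 := by
  refine ⟨fun h x => by rw [← he.smul_self i (a • x), ← mul_smul, h, zero_smul],
    fun h => he.faithful _ fun j x => ?_⟩
  rw [mul_smul]
  rcases eq_or_ne j i with rfl | hj
  · rw [h, smul_zero]
  · rw [he.smul_other i j hj]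

theorem sum_eq_one [Fintype ι] (he : IsBlockSystem V e) : ∑ i, e i = 1 := by
  refine he.ext fun i x => ?_
  rw [Finset.sum_smul, Fintype.sum_eq_single i fun j hj => he.smul_other j i hj.symm x,
    he.smul_self, one_smul]

variable [∀ i, Module k (V i)] [∀ i, IsScalarTower k A (V i)]

theorem sum_smul_smul [Fintype ι] (he : IsBlockSystem V e) (c : ι → k) (i : ι) (x : V i) :
    (∑ j, c j • e j) • x = c i • x := by
  rw [Finset.sum_smul, Fintype.sum_eq_single i fun j hj => by
    rw [smul_assoc, he.smul_other j i hj.symm, smul_zero], smul_assoc, he.smul_self]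

theorem isUnit_sum_smul [Fintype ι] (he : IsBlockSystem V e) {c : ι → k} (hc : ∀ i, c i ≠ 0) :
    IsUnit (∑ i, c i • e i) := by
  have hmul (a b : ι → k) (hab : ∀ i, a i * b i = 1) :
      (∑ i, a i • e i) * (∑ i, b i • e i) = 1 := by
    refine he.ext fun i x => ?_
    rw [mul_smul, he.sum_smul_smul, he.sum_smul_smul, smul_smul, hab, one_smul, one_smul]
  exact ⟨⟨_, ∑ i, (c i)⁻¹ • e i, hmul _ _ fun i => mul_inv_cancel₀ (hc i),
    hmul _ _ fun i => inv_mul_cancel₀ (hc i)⟩, rfl⟩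

theorem lsmul_self (he : IsBlockSystem V e) (i : ι) : Algebra.lsmul k k (V i) (e i) = 1 :=
  LinearMap.ext (he.smul_self i)

theorem lsmul_other (he : IsBlockSystem V e) {i j : ι} (hj : j ≠ i) :
    Algebra.lsmul k k (V j) (e i) = 0 :=
  LinearMap.ext (he.smul_other i j hj)

theorem character_mul_self (he : IsBlockSystem V e) (i : ι) (a : A) :
    character k A (V i) (e i * a) = character k A (V i) a := by
  rw [character_apply, map_mul, he.lsmul_self, one_mul, character_apply]

theorem character_mul_other (he : IsBlockSystem V e) {i j : ι} (hj : j ≠ i) (a : A) :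
    character k A (V j) (e i * a) = 0 := by
  rw [character_apply, map_mul, he.lsmul_other hj, zero_mul, map_zero]

variable [∀ i, Module.Finite k (V i)] [IsAlgClosed k] [∀ i, IsSimpleModule A (V i)]

theorem linearIndependent_character (he : IsBlockSystem V e) :
    LinearIndependent k fun i => character k A (V i) := by
  rw [linearIndependent_iff']
  intro s c hc i hi
  obtain ⟨a, ha⟩ := DFunLike.ne_iff.mp (character_ne_zero (k := k) (A := A) (V i))
  have h : ∑ j ∈ s, c j * character k A (V j) (e i * a) = 0 := by
    simpa using LinearMap.congr_fun hc (e i * a)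
  rw [Finset.sum_eq_single_of_mem i hi fun j _ hj => by
    rw [he.character_mul_other hj, mul_zero], he.character_mul_self] at h
  exact (mul_eq_zero.mp h).resolve_right ha

theorem exists_apply_mul_eq_of_mem_traceForms (he : IsBlockSystem V e) {f : Dual k A}
    (hf : f ∈ traceForms k A) (i : ι) : ∃ c, ∀ a, f (e i * a) = c * character k A (V i) a := by
  set Φ : A →ₐ[k] End k (V i) := Algebra.lsmul k k (V i)
  have htrace : f ∘ₗ LinearMap.mulLeft k (e i) ∈ traceForms k A := fun a b => by
    simp only [LinearMap.comp_apply, LinearMap.mulLeft_apply]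
    rw [← mul_assoc, hf, ← mul_assoc, ← (he.commute i b).eq, mul_assoc]
  have hrange : f ∘ₗ LinearMap.mulLeft k (e i) ∈ LinearMap.range Φ.toLinearMap.dualMap := by
    rw [LinearMap.range_dualMap_eq_dualAnnihilator_ker, Submodule.mem_dualAnnihilator]
    intro a ha
    rw [LinearMap.comp_apply, LinearMap.mulLeft_apply,
      (he.mul_eq_zero_iff i a).mpr (LinearMap.congr_fun ha), map_zero]
  obtain ⟨g, hg⟩ := hrange
  obtain ⟨c, rfl⟩ := exists_eq_smul_trace_of_mem_traceForms
    (mem_traceForms_of_comp_algHom (Φ := Φ) (lsmul_surjective (V i)) (hg ▸ htrace))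
  exact ⟨c, fun a => (LinearMap.congr_fun hg a).symm⟩

theorem span_range_character [Finite ι] (he : IsBlockSystem V e) :
    Submodule.span k (Set.range fun i => character k A (V i)) = traceForms k A := by
  have := Fintype.ofFinite ι
  refine le_antisymm (Submodule.span_le.mpr ?_) fun f hf => ?_
  · rintro _ ⟨i, rfl⟩
    exact character_mem_traceForms k A (V i)
  choose c hc using he.exists_apply_mul_eq_of_mem_traceForms hf
  refine (Submodule.mem_span_range_iff_exists_fun k).mpr ⟨c, LinearMap.ext fun a => ?_⟩
  calc (∑ i, c i • character k A (V i)) a = ∑ i, f (e i * a) := by simp [hc]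
    _ = f a := by rw [← map_sum, ← Finset.sum_mul, he.sum_eq_one, one_mul]

variable [Module.Finite k A]

theorem character_regular_mul (he : IsBlockSystem V e) (i : ι) (a : A) :
    character k A A (e i * a) = finrank k (V i) * character k A (V i) a := by
  set Φ : A →ₐ[k] End k (V i) := Algebra.lsmul k k (V i)
  have hker : Algebra.lsmul k k A (e i * a) ∘ₗ (LinearMap.ker Φ.toLinearMap).subtype =
      (LinearMap.ker Φ.toLinearMap).subtype ∘ₗ 0 := by
    ext ⟨x, hx⟩
    have hax : e i * (a * x) = 0 := (he.mul_eq_zero_iff i _).mpr fun y => by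
      rw [mul_smul, show x • y = 0 from LinearMap.congr_fun hx y, smul_zero]
    simpa [mul_assoc] using hax
  have hΦ : Φ.toLinearMap ∘ₗ Algebra.lsmul k k A (e i * a) =
      LinearMap.mulLeft k (Φ a) ∘ₗ Φ.toLinearMap := by
    ext1 x
    simp [Φ, he.lsmul_self]
  rw [character_apply, trace_of_exact _ _ (Submodule.injective_subtype _)
    (lsmul_surjective (V i)) (LinearMap.exact_subtype_ker_map _) _ _ _ hker hΦ, map_zero, zero_add,
    trace_mulLeft_end, character_apply]

theorem eq_zero_of_character_regular_mul_eq_zero (he : IsBlockSystem V e)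
    (hd : ∀ i, (finrank k (V i) : k) ≠ 0) {b : A} (hb : ∀ a, character k A A (a * b) = 0) :
    b = 0 := by
  refine he.faithful b fun i x => (forall_dual_apply_eq_zero_iff k _).mp fun φ => ?_
  obtain ⟨a, ha⟩ := lsmul_surjective (A := A) (V i) (φ.smulRight x)
  have hrank_one : Algebra.lsmul k k (V i) b * φ.smulRight x = φ.smulRight (b • x) := by
    ext; simp
  have h := hb (e i * a)
  rw [mul_assoc, he.character_regular_mul] at h
  rw [← LinearMap.trace_smulRight, ← hrank_one, ← ha, LinearMap.trace_mul_comm, ← map_mul,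
    ← character_apply]
  exact (mul_eq_zero.mp h).resolve_left (hd i)

end IsBlockSystem

end SimpleModules

section Grothendieck

namespace G0

/-- The class `[M]` in `G₀(A)` of a finite dimensional `A`-module `M`. -/
def of {k : Type w} [Field k] {A : Type u} [Ring A] [Algebra k A] (M : FinModule.{w, u} k A) :
    G0.{w, u} k A :=
  QuotientAddGroup.mk (FreeAbelianGroup.of M)

variable {k : Type w} [Field k] {A : Type u} [Ring A] [Algebra k A]

theorem of_exact {L M N : FinModule.{w, u} k A} {f : L.carrier →ₗ[A] M.carrier}
    {g : M.carrier →ₗ[A] N.carrier} (hf : Function.Injective f) (hg : Function.Surjective g)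
    (hfg : Function.Exact f g) : of M = of L + of N := by
  have h : FreeAbelianGroup.of M - FreeAbelianGroup.of L - FreeAbelianGroup.of N ∈
      exactRelations.{w, u} k A :=
    AddSubgroup.subset_closure ⟨L, M, N, f, g, hf, hg, hfg, rfl⟩
  rwa [← QuotientAddGroup.eq_zero_iff, QuotientAddGroup.mk_sub, QuotientAddGroup.mk_sub, sub_sub,
    sub_eq_zero] at h

theorem of_subsingleton (M : FinModule.{w, u} k A) [Subsingleton M.carrier] : of M = 0 := by
  simpa using of_exact (L := M) (M := M) (N := M) (f := LinearMap.id) (g := LinearMap.id)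
    Function.injective_id Function.surjective_id
    fun x => ⟨fun _ => ⟨x, rfl⟩, fun _ => Subsingleton.elim _ _⟩

theorem of_equiv {L M : FinModule.{w, u} k A} (φ : L.carrier ≃ₗ[A] M.carrier) :
    of L = of M := by
  let Z : FinModule.{w, u} k A := FinModule.mk PUnit.{u + 1}
  have : Subsingleton Z.carrier := inferInstanceAs (Subsingleton PUnit.{u + 1})
  rw [of_exact (M := M) (N := Z) (g := 0) φ.injective (Function.surjective_to_subsingleton _)
    fun x => ⟨fun _ => φ.surjective x, fun _ => Subsingleton.elim _ _⟩, of_subsingleton Z, add_zero]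

variable {ι : Type*} {V : ι → Type u} [∀ i, AddCommGroup (V i)] [∀ i, Module k (V i)]
  [∀ i, Module A (V i)] [∀ i, IsScalarTower k A (V i)] [∀ i, Module.Finite k (V i)]

theorem of_mem_closure_of_isFiniteLength (hV : IsCompleteListOfSimples A V) {M : Type u}
    [AddCommGroup M] [Module A M] (hM : IsFiniteLength A M) [Module k M] [IsScalarTower k A M]
    [Module.Finite k M] :
    of (FinModule.mk M) ∈
      AddSubgroup.closure (Set.range fun i => of (FinModule.mk (k := k) (H := A) (V i))) := by
  rename_i hkM hkAM hfin
  induction hM generalizing hkM with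
  | of_subsingleton =>
    rw [of_subsingleton]
    exact zero_mem _
  | of_simple_quotient _ ih =>
    rename_i M _ _ N _ _
    have hN : Module.Finite k N :=
      Module.Finite.of_injective (N.subtype.restrictScalars k) N.subtype_injective
    have hQ : Module.Finite k (M ⧸ N) :=
      Module.Finite.of_surjective (N.mkQ.restrictScalars k) N.mkQ_surjective
    obtain ⟨i, ⟨φ⟩⟩ := hV (M ⧸ N)
    rw [of_exact (L := FinModule.mk N) (N := FinModule.mk (M ⧸ N)) N.subtype_injective
      N.mkQ_surjective (LinearMap.exact_subtype_mkQ N),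
      of_equiv (L := FinModule.mk (M ⧸ N)) (M := FinModule.mk (V i)) φ]
    exact add_mem ih (AddSubgroup.subset_closure ⟨i, rfl⟩)

theorem closure_range_of (hV : IsCompleteListOfSimples A V) :
    AddSubgroup.closure (Set.range fun i => of (FinModule.mk (k := k) (H := A) (V i))) = ⊤ := by
  refine (AddSubgroup.eq_top_iff' _).mpr fun x => ?_
  obtain ⟨x, rfl⟩ := QuotientAddGroup.mk_surjective x
  induction x using FreeAbelianGroup.induction_on with
  | zero => exact zero_mem _
  | of M =>
    exact of_mem_closure_of_isFiniteLength hV (isFiniteLength_iff_isNoetherian_isArtinian.mpr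
      ⟨isNoetherian_of_tower k inferInstance, isArtinian_of_tower k inferInstance⟩)
  | neg M h => exact neg_mem h
  | add x y hx hy => exact add_mem hx hy

end G0

variable {k : Type w} [Field k] {A : Type u} [Ring A] [Algebra k A]
  {ι : Type*} {V : ι → Type u} [∀ i, AddCommGroup (V i)] [∀ i, Module k (V i)]
  [∀ i, Module A (V i)] [∀ i, IsScalarTower k A (V i)] [∀ i, Module.Finite k (V i)]

theorem span_range_cls (hV : IsCompleteListOfSimples A V) :
    Submodule.span k (Set.range fun i => cls.{w, u} k A (V i)) = ⊤ := by
  have hcls : (Set.range fun i => cls.{w, u} k A (V i)) =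
      TensorProduct.mk ℤ k (G0.{w, u} k A) 1 ''
        Set.range fun i => G0.of (FinModule.mk (k := k) (H := A) (V i)) :=
    Set.range_comp _ _
  have hspan : Submodule.span ℤ (Set.range fun i =>
      G0.of (FinModule.mk (k := k) (H := A) (V i))) = ⊤ :=
    Submodule.toAddSubgroup_injective (by
      rw [Submodule.span_int_eq_addSubgroupClosure, G0.closure_range_of hV]; rfl)
  rw [hcls, ← Submodule.baseChange_span, hspan, Submodule.baseChange_top]

variable [IsAlgClosed k] [∀ i, IsSimpleModule A (V i)] {e : ι → A}

theorem IsBlockSystem.characterMap_injective (he : IsBlockSystem V e)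
    (hV : IsCompleteListOfSimples A V) : Function.Injective (characterMap.{w, u} k A) := by
  refine LinearMap.injective_of_linearIndependent (span_range_cls hV) ?_
  simpa only [Function.comp_def, characterMap_cls] using he.linearIndependent_character (k := k)

theorem IsBlockSystem.range_characterMap [Finite ι] (he : IsBlockSystem V e)
    (hV : IsCompleteListOfSimples A V) :
    LinearMap.range (characterMap.{w, u} k A) = traceForms k A := by
  rw [LinearMap.range_eq_map, ← span_range_cls hV, Submodule.map_span, ← Set.range_comp,
    ← he.span_range_character]
  simp only [Function.comp_def, characterMap_cls]

end Grothendieck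

section TrivialModule

open Coalgebra

/-- `H` acts on the module `W` through its counit. -/
def IsTrivialModule (k : Type*) [Field k] (H : Type*) [Ring H] [HopfAlgebra k H] (W : Type*)
    [AddCommGroup W] [Module k W] [Module H W] : Prop :=
  ∀ (h : H) (x : W), h • x = (counit h : k) • x

namespace IsTrivialModule

variable {k : Type*} [Field k] {H : Type*} [Ring H] [HopfAlgebra k H]
  {W : Type*} [AddCommGroup W] [Module k W] [Module H W]

theorem counit_eq_of_forall_smul_eq_smul [Nontrivial W] (hW : IsTrivialModule k H W) {h : H}
    {c : k} (hc : ∀ x : W, h • x = c • x) : counit h = c := by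
  obtain ⟨x, hx⟩ := exists_ne (0 : W)
  exact smul_left_injective k hx ((hW h x).symm.trans (hc x))

theorem finrank_eq_one [IsSimpleModule H W] (hW : IsTrivialModule k H W) :
    Module.finrank k W = 1 := by
  have := IsSimpleModule.nontrivial H W
  obtain ⟨x, hx⟩ := exists_ne (0 : W)
  refine _root_.finrank_eq_one x hx fun y => ?_
  obtain ⟨h, rfl⟩ := IsSimpleModule.toSpanSingleton_surjective H hx y
  exact ⟨counit h, (hW h x).symm⟩

theorem character_eq_counit [IsScalarTower k H W] [IsSimpleModule H W]
    (hW : IsTrivialModule k H W) : character k H W = counit := by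
  ext h
  have hsmul : Algebra.lsmul k k W h = (counit h : k) • 1 := LinearMap.ext (hW h)
  have := Module.finite_of_finrank_eq_succ hW.finrank_eq_one
  rw [character_apply, hsmul, map_smul, LinearMap.trace_one, hW.finrank_eq_one, Nat.cast_one,
    smul_eq_mul, mul_one]

end IsTrivialModule

end TrivialModule

section BlockIntegrals

open Coalgebra HopfAlgebra Module

variable {k : Type w} [Field k] {H : Type u} [Ring H] [HopfAlgebra k H]
  {ι : Type*} {V : ι → Type*} [∀ i, AddCommGroup (V i)] [∀ i, Module H (V i)] {e : ι → H}

theorem comp_antipode_mem_traceForms {f : Dual k H} (hf : f ∈ traceForms k H) :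
    f ∘ₗ antipode k ∈ traceForms k H := fun a b => by
  simp [antipode_mul_antidistrib, hf (antipode k a)]

theorem character_antipode_uElt (W : Type*) [AddCommGroup W] [Module k W] [Module H W]
    [IsScalarTower k H W] [Module.Finite k W] (Λ : H) :
    character k H W (antipode k (uElt k Λ)) = counit Λ * finrank k W := by
  have h := apply_uElt_of_mem_traceForms
    (comp_antipode_mem_traceForms (character_mem_traceForms k H W)) Λ
  rwa [LinearMap.comp_apply, LinearMap.comp_apply, antipode_one, character_one] at h

theorem IsDualIntegralPair.commute_antipode_uElt_mul_uElt {Λ : H} {lam : Dual k H}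
    (hΛ : IsDualIntegralPair Λ lam) (hΛr : IsRightIntegralElt k Λ) (a : H) :
    Commute (antipode k (uElt k Λ) * uElt k Λ) a := by
  obtain ⟨b, rfl⟩ := hΛ.antipode_surjective a
  have hSu : SemiconjBy (antipode k (uElt k Λ)) (antipode k (antipode k (antipode k b)))
      (antipode k b) := by
    rw [SemiconjBy, ← antipode_mul_antidistrib, ← antipode_mul_antidistrib,
      (hΛr.semiconjBy_uElt b).eq]
  exact hSu.mul_left (hΛr.semiconjBy_uElt _)

namespace IsBlockSystem

section TrivialBlock

variable [∀ i, Module k (V i)] {i₀ : ι} [Nontrivial (V i₀)]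

theorem counit_self (he : IsBlockSystem V e) (hi₀ : IsTrivialModule k H (V i₀)) :
    (counit (e i₀) : k) = 1 :=
  hi₀.counit_eq_of_forall_smul_eq_smul fun x => by rw [he.smul_self, one_smul]

theorem counit_other (he : IsBlockSystem V e) (hi₀ : IsTrivialModule k H (V i₀)) {j : ι}
    (hj : j ≠ i₀) : (counit (e j) : k) = 0 :=
  hi₀.counit_eq_of_forall_smul_eq_smul fun x => by rw [he.smul_other j i₀ hj.symm, zero_smul]

theorem counit_sum_smul [Fintype ι] (he : IsBlockSystem V e) (hi₀ : IsTrivialModule k H (V i₀))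
    (c : ι → k) : counit (∑ i, c i • e i) = c i₀ := by
  rw [map_sum, Fintype.sum_eq_single i₀ fun j hj => by
    rw [map_smul, he.counit_other hi₀ hj, smul_zero], map_smul, he.counit_self hi₀, smul_eq_mul,
    mul_one]

end TrivialBlock

variable [∀ i, Module k (V i)] [∀ i, IsScalarTower k H (V i)]

section LeftIntegral

variable {i₀ : ι}

theorem isLeftIntegral (he : IsBlockSystem V e) (hi₀ : IsTrivialModule k H (V i₀)) :
    IsLeftIntegral k (e i₀) := by
  refine fun h => he.ext fun j x => ?_
  rw [mul_smul, smul_assoc]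
  rcases eq_or_ne j i₀ with rfl | hj
  · rw [he.smul_self, hi₀]
  · rw [he.smul_other i₀ j hj, smul_zero, smul_zero]

variable [Nontrivial (V i₀)] {Λ : H}

theorem eq_counit_smul (he : IsBlockSystem V e) (hi₀ : IsTrivialModule k H (V i₀))
    (hΛ : IsLeftIntegral k Λ) : Λ = (counit Λ : k) • e i₀ := by
  rw [← he.isLeftIntegral hi₀, ← (he.commute i₀ Λ).eq, hΛ, he.counit_self hi₀, one_smul]

theorem isRightIntegralElt (he : IsBlockSystem V e) (hi₀ : IsTrivialModule k H (V i₀))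
    (hΛ : IsLeftIntegral k Λ) : IsRightIntegralElt k Λ := fun h => by
  rw [he.eq_counit_smul hi₀ hΛ, smul_mul_assoc, (he.commute i₀ h).eq, he.isLeftIntegral hi₀,
    smul_comm]

theorem counit_mul_apply_idempotent_trivial (he : IsBlockSystem V e)
    (hi₀ : IsTrivialModule k H (V i₀)) {lam : Dual k H} (hΛ : IsDualIntegralPair Λ lam) :
    counit Λ * lam (e i₀) = 1 := by
  rw [← smul_eq_mul, ← map_smul, ← he.eq_counit_smul hi₀ hΛ.left, hΛ.apply_eq_one]

end LeftIntegral

variable [Module.Finite k H] [IsAlgClosed k] [∀ i, Module.Finite k (V i)]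
  [∀ i, IsSimpleModule H (V i)] {Λ : H} {lam : Dual k H}

theorem isUnit_uElt (he : IsBlockSystem V e) (hd : ∀ i, (finrank k (V i) : k) ≠ 0)
    (hΛ : IsDualIntegralPair Λ lam) : IsUnit (uElt k Λ) := by
  have : IsArtinianRing H := .of_finite k H
  rw [IsArtinianRing.isUnit_iff_isRightRegular, isRightRegular_iff_left_eq_zero_of_mul]
  refine fun c hc => he.eq_zero_of_character_regular_mul_eq_zero hd fun a => ?_
  rw [← hΛ.apply_mul_uElt, mul_assoc, hc, mul_zero, map_zero]

theorem counit_mul_apply_idempotent (he : IsBlockSystem V e) (hΛ : IsDualIntegralPair Λ lam)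
    (hS : ∀ h : H, antipode k (antipode k h) = h) (i : ι) :
    counit Λ * lam (e i) = (finrank k (V i) : k) ^ 2 := by
  calc counit Λ * lam (e i) = lam (e i * 1 * uElt k Λ) := by
        rw [uElt_of_antipode_antipode hS, mul_smul_comm, mul_one, mul_one, map_smul, smul_eq_mul]
    _ = (finrank k (V i) : k) ^ 2 := by
        rw [hΛ.apply_mul_uElt, he.character_regular_mul, character_one, sq]

theorem apply_idempotent_eq (he : IsBlockSystem V e) (hd : ∀ i, (finrank k (V i) : k) ≠ 0)
    (hΛ : IsDualIntegralPair Λ lam) (i : ι) :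
    lam (e i) = finrank k (V i) * character k H (V i) (Ring.inverse (uElt k Λ)) := by
  rw [← he.character_regular_mul, ← hΛ.apply_mul_uElt,
    Ring.inverse_mul_cancel_right _ _ (he.isUnit_uElt hd hΛ)]

-- The central element `S(u) u` acts on `V i` by a scalar `c`, so `S(u)` acts as `c u⁻¹` and
-- `c λ(eᵢ) = dᵢ χᵢ(S(u)) = dᵢ² ε(Λ)`.
theorem apply_idempotent_ne_zero (he : IsBlockSystem V e)
    (hd : ∀ i, (finrank k (V i) : k) ≠ 0) (hΛ : IsDualIntegralPair Λ lam)
    (hΛr : IsRightIntegralElt k Λ) (hΛε : (counit Λ : k) ≠ 0) (i : ι) : lam (e i) ≠ 0 := by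
  set u := uElt k Λ with hu
  have hunit : IsUnit u := he.isUnit_uElt hd hΛ
  obtain ⟨c, hc⟩ := exists_forall_smul_eq_smul_of_forall_commute (k := k) (V i)
    (hΛ.commute_antipode_uElt_mul_uElt hΛr)
  have hlsmul : Algebra.lsmul k k (V i) (antipode k u) =
      c • Algebra.lsmul k k (V i) (Ring.inverse u) := by
    ext x
    simp only [Algebra.lsmul_coe, LinearMap.smul_apply]
    rw [← hc, smul_smul, Ring.mul_inverse_cancel_right _ _ hunit]
  have hchar : c * character k H (V i) (Ring.inverse u) = counit Λ * finrank k (V i) := by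
    rw [← character_antipode_uElt (V i) Λ, ← hu, character_apply, character_apply, hlsmul,
      map_smul, smul_eq_mul]
  rw [he.apply_idempotent_eq hd hΛ, ← hu]
  exact mul_ne_zero (hd i) (right_ne_zero_of_mul (hchar ▸ mul_ne_zero hΛε (hd i)))

end IsBlockSystem

end BlockIntegrals

section TwistingElement

open Coalgebra HopfAlgebra

variable {k : Type w} [Field k] {H : Type u} [Ring H] [HopfAlgebra k H]
  {ι : Type*} [Fintype ι] {V : ι → Type*} [∀ i, AddCommGroup (V i)] [∀ i, Module H (V i)]
  {e : ι → H} {Λ : H} {d : ι → ℕ} {s : k} {r : ι → k}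

namespace IsBlockSystem

theorem semiconjBy_vElt (he : IsBlockSystem V e) (hΛ : IsRightIntegralElt k Λ) (h : H) :
    SemiconjBy (vElt Λ e d s r) h (antipode k (antipode k h)) := by
  refine SemiconjBy.mul_left ?_ (Commute.sum_left _ _ _ fun i _ => (he.commute i h).smul_left _)
  rw [SemiconjBy, smul_mul_assoc, (hΛ.semiconjBy_uElt h).eq, mul_smul_comm]

variable [∀ i, Module k (V i)]

theorem counit_vElt (he : IsBlockSystem V e) {i₀ : ι} [Nontrivial (V i₀)]
    (hi₀ : IsTrivialModule k H (V i₀)) (hd : d i₀ = 1) (hs : s ^ 2 = counit Λ) :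
    (counit (vElt Λ e d s r) : k) = s * r i₀ := by
  rw [vElt, Bialgebra.counit_mul, he.counit_sum_smul hi₀, map_smul, counit_uElt, ← hs, hd,
    Nat.cast_one, div_one, smul_eq_mul, sq, ← mul_assoc, inv_mul_mul_self]

variable [∀ i, IsScalarTower k H (V i)]

theorem isUnit_vElt (he : IsBlockSystem V e) (hu : IsUnit (uElt k Λ)) (hd : ∀ i, (d i : k) ≠ 0)
    (hs : s ≠ 0) (hr : ∀ i, r i ≠ 0) : IsUnit (vElt Λ e d s r) :=
  (hu.smul (Units.mk0 s⁻¹ (inv_ne_zero hs))).mul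
    (he.isUnit_sum_smul fun i => div_ne_zero (hr i) (hd i))

theorem vElt_eq_one (he : IsBlockSystem V e) (hS : ∀ h : H, antipode k (antipode k h) = h)
    (hd : ∀ i, (d i : k) ≠ 0) (hs : s ^ 2 = counit Λ) (hsr : ∀ i, s * r i = d i) :
    vElt Λ e d s r = 1 := by
  refine he.ext fun i x => ?_
  have hs₀ : s ≠ 0 := left_ne_zero_of_mul (hsr i ▸ hd i)
  have hr₀ : r i ≠ 0 := right_ne_zero_of_mul (hsr i ▸ hd i)
  rw [vElt, mul_smul, he.sum_smul_smul, uElt_of_antipode_antipode hS, ← hs, smul_smul,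
    smul_assoc, one_smul, one_smul, smul_smul, ← hsr i]
  rw [show s⁻¹ * s ^ 2 * (r i / (s * r i)) = 1 by field_simp, one_smul]

end IsBlockSystem

theorem exists_sqrt_mul_eq {K : Type*} [Field K] [IsAlgClosed K] {κ : Type*} {c : K} (hc : c ≠ 0)
    (a b : κ → K) : ∃ (s : K) (r : κ → K), s ^ 2 = c ∧ (∀ i, r i ^ 2 = a i) ∧
      ∀ i, c * a i = b i ^ 2 → s * r i = b i := by
  obtain ⟨s, rfl⟩ := IsAlgClosed.exists_pow_nat_eq c two_pos
  have hs : s ≠ 0 := pow_ne_zero_iff two_ne_zero |>.mp hc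
  have hroot (i) : ∃ r, r ^ 2 = a i ∧ (s ^ 2 * a i = b i ^ 2 → s * r = b i) := by
    by_cases h : s ^ 2 * a i = b i ^ 2
    · refine ⟨b i / s, ?_, fun _ => mul_div_cancel₀ _ hs⟩
      rw [div_pow, ← h, mul_div_cancel_left₀ _ hc]
    · obtain ⟨r, hr⟩ := IsAlgClosed.exists_pow_nat_eq (a i) two_pos
      exact ⟨r, hr, fun h' => absurd h' h⟩
  choose r hr hsr using hroot
  exact ⟨s, r, rfl, hr, hsr⟩

end TwistingElement

section StarAlgebra

open Coalgebra HopfAlgebra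

variable {k : Type w} [Field k] {H : Type u} [Ring H] [HopfAlgebra k H] {v : H}

theorem IsBlockSystem.star_characterMap_mem_range [IsAlgClosed k] {ι : Type*} [Finite ι]
    {V : ι → Type u} [∀ i, AddCommGroup (V i)] [∀ i, Module k (V i)] [∀ i, Module H (V i)]
    [∀ i, IsScalarTower k H (V i)] [∀ i, Module.Finite k (V i)] [∀ i, IsSimpleModule H (V i)]
    {e : ι → H} (he : IsBlockSystem V e) (hV : IsCompleteListOfSimples H V) (hv : IsUnit v)
    (hvS : ∀ h, SemiconjBy v h (antipode k (antipode k h))) (x y : G0k.{w, u} k H) :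
    star v (characterMap.{w, u} k H x) (characterMap.{w, u} k H y) ∈
      LinearMap.range (characterMap.{w, u} k H) := by
  have hrange := he.range_characterMap (k := k) hV
  rw [hrange]
  exact star_mem_traceForms hv hvS (hrange ▸ ⟨x, rfl⟩) (hrange ▸ ⟨y, rfl⟩)

/-- The product on `G₀(H) ⊗ k` that becomes `⋆` when classes are regarded as linear functions
on `H`. -/
def starMul (hinj : Function.Injective (characterMap.{w, u} k H))
    (hmem : ∀ x y, star v (characterMap.{w, u} k H x) (characterMap.{w, u} k H y) ∈
      LinearMap.range (characterMap.{w, u} k H)) :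
    G0k.{w, u} k H →ₗ[k] G0k.{w, u} k H →ₗ[k] G0k.{w, u} k H :=
  LinearMap.codRestrict₂ ((starBilin v).compl₁₂ (characterMap.{w, u} k H) (characterMap.{w, u} k H))
    (characterMap.{w, u} k H) hinj hmem

variable (hinj : Function.Injective (characterMap.{w, u} k H))
  (hmem : ∀ x y, star v (characterMap.{w, u} k H x) (characterMap.{w, u} k H y) ∈
    LinearMap.range (characterMap.{w, u} k H))

@[simp]
theorem characterMap_starMul (x y : G0k.{w, u} k H) :
    characterMap.{w, u} k H (starMul hinj hmem x y) =
      star v (characterMap.{w, u} k H x) (characterMap.{w, u} k H y) :=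
  LinearMap.codRestrict₂_apply ..

theorem starMul_assoc (hv : IsUnit v) (x y z : G0k.{w, u} k H) :
    starMul hinj hmem (starMul hinj hmem x y) z = starMul hinj hmem x (starMul hinj hmem y z) :=
  hinj (by simp only [characterMap_starMul, star_assoc hv])

theorem starMul_of_characterMap_eq_counit_left (hv : IsUnit v) (hvε : (counit v : k) = 1)
    {x : G0k.{w, u} k H} (hx : characterMap.{w, u} k H x = counit) (y : G0k.{w, u} k H) :
    starMul hinj hmem x y = y :=
  hinj (by rw [characterMap_starMul, hx, counit_star hv, hvε, one_smul])

theorem starMul_of_characterMap_eq_counit_right (hv : IsUnit v) (hvε : (counit v : k) = 1)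
    {y : G0k.{w, u} k H} (hy : characterMap.{w, u} k H y = counit) (x : G0k.{w, u} k H) :
    starMul hinj hmem x y = x :=
  hinj (by rw [characterMap_starMul, hy, star_counit hv, hvε, one_smul])

end StarAlgebra

end HopfStar

end

theorem mainTheorem8_general {k : Type w} [Field k] [IsAlgClosed k] {H : Type u} [Ring H]
    [HopfAlgebra k H] [Module.Finite k H]
    {ι : Type*} [Fintype ι] {V : ι → Type u} [∀ i, AddCommGroup (V i)] [∀ i, Module k (V i)]
    [∀ i, Module H (V i)] [∀ i, IsScalarTower k H (V i)] [∀ i, Module.Finite k (V i)]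
    [∀ i, IsSimpleModule H (V i)]
    (hd : ∀ i, (Module.finrank k (V i) : k) ≠ 0)
    (hV_all : HopfStar.IsCompleteListOfSimples H V)
    {i₀ : ι} (hi₀ : HopfStar.IsTrivialModule k H (V i₀))
    {e : ι → H} (he : HopfStar.IsBlockSystem V e)
    {Λ : H} {lam : Module.Dual k H} (hΛ : HopfStar.IsDualIntegralPair Λ lam) :
    Function.Injective (HopfStar.characterMap.{w, u} k H) ∧
    HopfStar.characterMap.{w, u} k H (HopfStar.cls.{w, u} k H (V i₀)) =
      (Coalgebra.counit : H →ₗ[k] k) ∧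
    (∃ (s : k) (r : ι → k), s ^ 2 = Coalgebra.counit Λ ∧ (∀ i, r i ^ 2 = lam (e i)) ∧
      s * r i₀ = 1 ∧
      ((∀ h : H, HopfAlgebra.antipode k (HopfAlgebra.antipode k h) = h) →
        ∀ i, s * r i = (Module.finrank k (V i) : k))) ∧
    ∀ (s : k) (r : ι → k), s ^ 2 = Coalgebra.counit Λ → (∀ i, r i ^ 2 = lam (e i)) →
      IsUnit (HopfStar.vElt Λ e (fun i => Module.finrank k (V i)) s r) ∧
      ∃ mul : HopfStar.G0k.{w, u} k H →ₗ[k] HopfStar.G0k.{w, u} k H →ₗ[k]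
          HopfStar.G0k.{w, u} k H,
        (∀ x y, HopfStar.characterMap.{w, u} k H (mul x y) =
          HopfStar.star (HopfStar.vElt Λ e (fun i => Module.finrank k (V i)) s r)
            (HopfStar.characterMap.{w, u} k H x) (HopfStar.characterMap.{w, u} k H y)) ∧
        (∀ x y z, mul (mul x y) z = mul x (mul y z)) ∧
        (s * r i₀ = 1 → ∀ x, mul (HopfStar.cls.{w, u} k H (V i₀)) x = x ∧
          mul x (HopfStar.cls.{w, u} k H (V i₀)) = x) ∧
        ((∀ h : H, HopfAlgebra.antipode k (HopfAlgebra.antipode k h) = h) →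
          (∀ i, s * r i = (Module.finrank k (V i) : k)) →
          ∀ x y, HopfStar.characterMap.{w, u} k H (mul x y) =
            HopfStar.conv (HopfStar.characterMap.{w, u} k H x)
              (HopfStar.characterMap.{w, u} k H y)) := by
  have := IsSimpleModule.nontrivial H (V i₀)
  have hinj := he.characterMap_injective (k := k) hV_all
  have htriv := (HopfStar.characterMap_cls k H (V i₀)).trans hi₀.character_eq_counit
  have hΛr := he.isRightIntegralElt hi₀ hΛ.left
  have hΛ₀ := he.counit_mul_apply_idempotent_trivial hi₀ hΛ
  have hΛε : (Coalgebra.counit Λ : k) ≠ 0 := left_ne_zero_of_mul_eq_one hΛ₀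
  refine ⟨hinj, htriv, ?_, fun s r hs hr => ?_⟩
  · obtain ⟨s, r, hs, hr, hsr⟩ := HopfStar.exists_sqrt_mul_eq hΛε (fun i => lam (e i))
      fun i => (Module.finrank k (V i) : k)
    have hd₀ : (Module.finrank k (V i₀) : k) = 1 := by rw [hi₀.finrank_eq_one, Nat.cast_one]
    exact ⟨s, r, hs, hr, hd₀ ▸ hsr i₀ (by rw [hΛ₀, hd₀, one_pow]),
      fun hS i => hsr i (he.counit_mul_apply_idempotent hΛ hS i)⟩
  have hs₀ : s ≠ 0 := by rintro rfl; simp [← hs] at hΛε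
  have hr₀ i : r i ≠ 0 := fun h =>
    he.apply_idempotent_ne_zero hd hΛ hΛr hΛε i (by rw [← hr, h, zero_pow two_ne_zero])
  have hv := he.isUnit_vElt (he.isUnit_uElt hd hΛ) hd hs₀ hr₀
  have hmem := he.star_characterMap_mem_range hV_all hv (he.semiconjBy_vElt hΛr)
  have hvε := he.counit_vElt (d := fun i => Module.finrank k (V i)) (r := r) hi₀
    hi₀.finrank_eq_one hs
  refine ⟨hv, HopfStar.starMul hinj hmem, HopfStar.characterMap_starMul hinj hmem,
    HopfStar.starMul_assoc hinj hmem hv, fun hsr x => ⟨?_, ?_⟩, fun hS hsr x y => ?_⟩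
  · exact HopfStar.starMul_of_characterMap_eq_counit_left hinj hmem hv (hvε.trans hsr) htriv x
  · exact HopfStar.starMul_of_characterMap_eq_counit_right hinj hmem hv (hvε.trans hsr) htriv x
  · rw [HopfStar.characterMap_starMul, he.vElt_eq_one hS hd hs hsr, HopfStar.star_one]

theorem mainTheorem8 {k : Type w} [Field k] [IsAlgClosed k] {H : Type u} [Ring H]
    [HopfAlgebra k H] [Module.Finite k H] [IsSemisimpleRing H]
    (p : ℕ) [CharP k p] (hp : 0 < p)
    (hp_sq : Module.finrank k H < p ^ 2) (hp_dvd : ¬ p ∣ 2 * Module.finrank k H)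
    -- a complete list of pairwise non-isomorphic simple modules, with the trivial one at `i₀`
    {ι : Type*} [Fintype ι] (V : ι → Type u) [∀ i, AddCommGroup (V i)] [∀ i, Module k (V i)]
    [∀ i, Module H (V i)] [∀ i, IsScalarTower k H (V i)] [∀ i, Module.Finite k (V i)]
    [∀ i, IsSimpleModule H (V i)]
    (hV_inj : ∀ i j, Nonempty (V i ≃ₗ[H] V j) → i = j)
    (hV_all : ∀ (W : Type u) [AddCommGroup W] [Module H W] [IsSimpleModule H W],
      ∃ i, Nonempty (W ≃ₗ[H] V i))
    (i₀ : ι) (hi₀ : ∀ (h : H) (x : V i₀), h • x = (Coalgebra.counit h : k) • x)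
    -- the central primitive idempotents
    (e : ι → H) (he_self : ∀ i (x : V i), e i • x = x)
    (he_other : ∀ i j, j ≠ i → ∀ x : V j, e i • x = 0)
    -- the integrals
    (Λ : H) (lam : Module.Dual k H) (hΛ : HopfStar.IsLeftIntegral k Λ)
    (hlam : HopfStar.IsRightIntegral lam) (hlamΛ : lam Λ = 1) :
    -- elements of `G₀(H) ⊗ k` are determined by the functions on `H` they define
    Function.Injective (HopfStar.characterMap.{w, u} k H) ∧
    -- the class of the trivial module is the function `ε`
    HopfStar.characterMap.{w, u} k H (HopfStar.cls.{w, u} k H (V i₀)) =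
      (Coalgebra.counit : H →ₗ[k] k) ∧
    -- the square roots can be chosen with the normalizations used below
    (∃ (s : k) (r : ι → k), s ^ 2 = Coalgebra.counit Λ ∧ (∀ i, r i ^ 2 = lam (e i)) ∧
      s * r i₀ = 1 ∧
      ((∀ h : H, HopfAlgebra.antipode k (HopfAlgebra.antipode k h) = h) →
        ∀ i, s * r i = (Module.finrank k (V i) : k))) ∧
    ∀ (s : k) (r : ι → k), s ^ 2 = Coalgebra.counit Λ → (∀ i, r i ^ 2 = lam (e i)) →
      IsUnit (HopfStar.vElt Λ e (fun i => Module.finrank k (V i)) s r) ∧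
      ∃ mul : HopfStar.G0k.{w, u} k H →ₗ[k] HopfStar.G0k.{w, u} k H →ₗ[k]
          HopfStar.G0k.{w, u} k H,
        (∀ x y, HopfStar.characterMap.{w, u} k H (mul x y) =
          HopfStar.star (HopfStar.vElt Λ e (fun i => Module.finrank k (V i)) s r)
            (HopfStar.characterMap.{w, u} k H x) (HopfStar.characterMap.{w, u} k H y)) ∧
        (∀ x y z, mul (mul x y) z = mul x (mul y z)) ∧
        (s * r i₀ = 1 → ∀ x, mul (HopfStar.cls.{w, u} k H (V i₀)) x = x ∧
          mul x (HopfStar.cls.{w, u} k H (V i₀)) = x) ∧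
        ((∀ h : H, HopfAlgebra.antipode k (HopfAlgebra.antipode k h) = h) →
          (∀ i, s * r i = (Module.finrank k (V i) : k)) →
          ∀ x y, HopfStar.characterMap.{w, u} k H (mul x y) =
            HopfStar.conv (HopfStar.characterMap.{w, u} k H x)
              (HopfStar.characterMap.{w, u} k H y)) :=
  mainTheorem8_general (fun i => HopfStar.finrank_cast_ne_zero (A := H) (V i) p hp_sq) hV_all hi₀
    ⟨fun _ => HopfStar.IsCompleteListOfSimples.eq_zero_of_forall_smul_eq_zero hV_all, he_self,
      he_other⟩ ⟨hΛ, hlam, hlamΛ⟩
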